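/- Let $B$ be a Polish space, meaning here a complete separable metric space. A $B$-field is a $1$-Lipschitz map $\pi_X\colon X\to B$ whose domain $X$ is a complete separable metric space; it is compact if $X$ is compact and nonempty. An isometric embedding of $B$-fields $X\to Y$ is an isometric embedding $\phi\colon X\to Y$ of metric spaces with $\pi_Y\circ\phi=\pi_X$; it is an isometry if $\phi$ is bijective, and an automorphism if moreover $X=Y$. For compact $B$-fields $X,Y$ put $$d_{GH}^B(X,Y)=\inf_{Z,\phi,\psi} d_H^Z(\phi(X),\psi(Y)),$$ the infimum being over all $B$-fields $Z$ and isometric embeddings of $B$-fields $\phi\colon X\to Z$, $\psi\colon Y\to Z$, where $d_H^Z$ is the Hausdorff distance in $Z$. Let $\mathfrak F_B$ be the set of isometry classes of compact $B$-fields. A $B$-field $\pi\colon U\to B$ is a Urysohn field over $B$ if for every finite $A\subseteq U$ (possibly empty), every metric space $A^*=A\sqcup\{a^*\}$ extending $A$, and every $1$-Lipschitz map $\varphi\colon A^*\to B$ with $\varphi|_A=\pi|_A$, there is an isometric embedding $\imath\colon A^*\to U$ with $\imath|_A$ the inclusion and $\pi\circ\imath=\varphi$. **Theorem.** Let $\pi\colon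 U\to B$ be a Urysohn field over $B$, let $F(U)$ be the space of its compact subfields (nonempty compact subsets of $U$, with $\pi$ restricted to them) with the Hausdorff distance $d_H^U$, and let $\mathrm{Aut}$ be the group of automorphisms of $\pi\colon U\to B$, acting on $F(U)$ by $(g,K)\mapsto g(K)$. Equip $F(U)/\mathrm{Aut}$ with the quotient metric $d_F^B$, i.e. the largest pseudometric for which the quotient map $F(U)\to F(U)/\mathrm{Aut}$ is $1$-Lipschitz. Then $d_{GH}^B$ is a metric on $\mathfrak F_B$, $d_F^B$ is a metric on $F(U)/\mathrm{Aut}$, for all $K,L\in F(U)$ $$d_F^B([K],[L])=\inf_{g,h\in \mathrm{Aut}} d_H^U(g(K),h(L))=\inf_{g\in \mathrm{Aut}} d_H^U(K,g(L)),$$ and the metric spaces $(\mathfrak F_B,d_{GH}^B)$ and $(F(U)/\mathrm{Aut},d_F^B)$ are isometric: there is a distance-preserving bijection between them. -/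

import Mathlib

open TopologicalSpace

universe u v

/-- A function `d` on pairs of points is a (real-valued) pseudometric. -/
structure IsPseudometric {α : Type*} (d : α → α → ℝ) : Prop where
  self : ∀ x, d x x = 0
  symm : ∀ x y, d x y = d y x
  triangle : ∀ x y z, d x z ≤ d x y + d y z

/-- A function `d` on pairs of points is a (real-valued) metric. -/
structure IsMetric {α : Type*} (d : α → α → ℝ) : Prop extends IsPseudometric d where
  eq_of_eq_zero : ∀ x y, d x y = 0 → x = y

/-- The quotient metric of a (pseudo)metric space by an equivalence relation: the largest
pseudometric on the quotient for which the quotient map is `1`-Lipschitz. -/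
noncomputable def quotientDist {α : Type*} [PseudoMetricSpace α] (s : Setoid α)
    (p q : Quotient s) : ℝ :=
  sSup {r : ℝ | ∃ ρ : Quotient s → Quotient s → ℝ, IsPseudometric ρ ∧
    (∀ x y : α, ρ (Quotient.mk s x) (Quotient.mk s y) ≤ dist x y) ∧ r = ρ p q}

/-- A `B`-field: a `1`-Lipschitz map `proj : X → B` defined on a complete separable metric
space `X`. -/
structure BField (B : Type u) [MetricSpace B] where
  carrier : Type v
  [metricSpace : MetricSpace carrier]
  [completeSpace : CompleteSpace carrier]
  [separableSpace : SeparableSpace carrier]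
  proj : carrier → B
  lipschitz_proj : LipschitzWith 1 proj

namespace BField

variable {B : Type u} [MetricSpace B]

instance : CoeSort (BField.{u, v} B) (Type v) := ⟨carrier⟩

attribute [instance] BField.metricSpace BField.completeSpace BField.separableSpace

/-- `φ : X → Y` is an isometric embedding of `B`-fields (over `B`). -/
def IsEmbedding (X Y : BField.{u, v} B) (φ : X → Y) : Prop :=
  Isometry φ ∧ ∀ x, Y.proj (φ x) = X.proj x

/-- Two `B`-fields are isometric: there is a bijective isometry between them over `B`. -/
def IsIsometric (X Y : BField.{u, v} B) : Prop :=
  ∃ e : X ≃ᵢ Y, ∀ x, Y.proj (e x) = X.proj x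

/-- Urysohn fields, by the one-point extension property: for every finite `A ⊆ U`, every metric on
`A* = A ⊔ {a*}` (here `Option A`, with `a* = none`) extending that of `A`, and every `1`-Lipschitz
`φ : A* → B` extending `π|_A`, there is an isometric embedding `ι : A* → U` over `B` that is
the inclusion on `A`. -/
def IsUrysohn (U : BField.{u, v} B) : Prop :=
  ∀ (A : Set U), A.Finite → ∀ [MetricSpace (Option A)],
    (∀ a b : A, dist (some a) (some b) = dist (a : U) (b : U)) →
    ∀ φ : Option A → B, LipschitzWith 1 φ → (∀ a : A, φ (some a) = U.proj a) →
    ∃ ι : Option A → U, Isometry ι ∧ (∀ a : A, ι (some a) = a) ∧ ∀ x, U.proj (ι x) = φ x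

/-- The automorphism group of a `B`-field. -/
def Aut (U : BField.{u, v} B) : Subgroup (U ≃ᵢ U) where
  carrier := {g | ∀ x, U.proj (g x) = U.proj x}
  one_mem' := fun _ => rfl
  mul_mem' := fun {g h} hg hh x => (hg (h x)).trans (hh x)
  inv_mem' := fun {g} hg x => by
    have h := hg (g⁻¹ x)
    rw [IsometryEquiv.apply_inv_self] at h
    exact h.symm

/-- The compact subfields of a `B`-field `U`, that is, the restrictions of `U.proj` to the nonempty
compact subsets of `U`. The `MetricSpace` structure is the Hausdorff distance. -/
abbrev CompactSubfield (U : BField.{u, v} B) : Type v := NonemptyCompacts U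

/-- An automorphism `g` of `U` acts on compact subfields by `K ↦ g '' K`. -/
instance (U : BField.{u, v} B) : MulAction U.Aut U.CompactSubfield where
  smul g K := K.map (g : U ≃ᵢ U) (g : U ≃ᵢ U).continuous
  one_smul K := NonemptyCompacts.map_id K
  mul_smul g h K := NonemptyCompacts.map_comp (g : U ≃ᵢ U) (h : U ≃ᵢ U)
    (g : U ≃ᵢ U).continuous (h : U ≃ᵢ U).continuous K

/-- The orbit space of compact subfields modulo automorphisms. -/
abbrev SubfieldQuotient (U : BField.{u, v} B) : Type v :=
  Quotient (MulAction.orbitRel U.Aut U.CompactSubfield)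

/-- The class of a compact subfield modulo automorphisms. -/
abbrev subfieldClass (U : BField.{u, v} B) (K : U.CompactSubfield) : U.SubfieldQuotient :=
  Quotient.mk (MulAction.orbitRel U.Aut U.CompactSubfield) K

/-- The quotient metric, on the orbit space, of the Hausdorff distance. -/
noncomputable def subfieldDist (U : BField.{u, v} B) : U.SubfieldQuotient → U.SubfieldQuotient → ℝ :=
  quotientDist (MulAction.orbitRel U.Aut U.CompactSubfield)

/-- The Gromov–Hausdorff distance over `B`: the infimum, over all `B`-fields `Z` and isometric
embeddings `φ`, `ψ` of `X`, `Y` in `Z` over `B`, of the Hausdorff distance of the images. -/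
noncomputable def ghDist (X Y : BField.{u, v} B) : ℝ :=
  sInf {r : ℝ | ∃ (Z : BField.{u, v} B) (φ : X → Z) (ψ : Y → Z),
    IsEmbedding X Z φ ∧ IsEmbedding Y Z ψ ∧
    r = Metric.hausdorffDist (Set.range φ) (Set.range ψ)}

theorem IsIsometric.refl (X : BField.{u, v} B) : IsIsometric X X :=
  ⟨IsometryEquiv.refl X, fun _ => rfl⟩

theorem IsIsometric.symm {X Y : BField.{u, v} B} (h : IsIsometric X Y) : IsIsometric Y X := by
  obtain ⟨e, he⟩ := h
  refine ⟨e.symm, fun y => ?_⟩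
  rw [← he (e.symm y), e.apply_symm_apply]

theorem IsIsometric.trans {X Y Z : BField.{u, v} B} (h : IsIsometric X Y)
    (h' : IsIsometric Y Z) : IsIsometric X Z := by
  obtain ⟨e, he⟩ := h
  obtain ⟨f, hf⟩ := h'
  exact ⟨e.trans f, fun x => (hf (e x)).trans (he x)⟩

theorem ghDist_le_aux {X X' Y Y' : BField.{u, v} B} (hX : IsIsometric X X')
    (hY : IsIsometric Y Y') :
    {r : ℝ | ∃ (Z : BField.{u, v} B) (φ : X → Z) (ψ : Y → Z),
      IsEmbedding X Z φ ∧ IsEmbedding Y Z ψ ∧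
      r = Metric.hausdorffDist (Set.range φ) (Set.range ψ)} ⊆
    {r : ℝ | ∃ (Z : BField.{u, v} B) (φ : X' → Z) (ψ : Y' → Z),
      IsEmbedding X' Z φ ∧ IsEmbedding Y' Z ψ ∧
      r = Metric.hausdorffDist (Set.range φ) (Set.range ψ)} := by
  obtain ⟨e, he⟩ := hX.symm
  obtain ⟨f, hf⟩ := hY.symm
  rintro r ⟨Z, φ, ψ, hφ, hψ, rfl⟩
  refine ⟨Z, φ ∘ e, ψ ∘ f, ⟨hφ.1.comp e.isometry, fun x => (hφ.2 (e x)).trans (he x)⟩,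
    ⟨hψ.1.comp f.isometry, fun x => (hψ.2 (f x)).trans (hf x)⟩, ?_⟩
  rw [e.surjective.range_comp, f.surjective.range_comp]

/-- The Gromov–Hausdorff distance only depends on isometry classes. -/
theorem ghDist_congr {X X' Y Y' : BField.{u, v} B} (hX : IsIsometric X X')
    (hY : IsIsometric Y Y') : ghDist X Y = ghDist X' Y' :=
  congrArg sInf (Set.Subset.antisymm (ghDist_le_aux hX hY) (ghDist_le_aux hX.symm hY.symm))

end BField

/-- A compact `B`-field: a `B`-field whose domain is compact (and nonempty). -/
structure CompactBField (B : Type u) [MetricSpace B] extends BField.{u, v} B where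
  compactSpace : CompactSpace carrier
  nonempty : Nonempty carrier

namespace CompactBField

variable (B : Type u) [MetricSpace B]

/-- The equivalence relation of being isometric over `B`. -/
instance isometrySetoid : Setoid (CompactBField.{u, v} B) where
  r X Y := BField.IsIsometric X.toBField Y.toBField
  iseqv := ⟨fun X => .refl X.toBField, fun h => h.symm, fun h h' => h.trans h'⟩

/-- The moduli space of isometry classes of compact `B`-fields. -/
abbrev Moduli : Type (max u (v + 1)) := Quotient (isometrySetoid.{u, v} B)

/-- The Gromov–Hausdorff distance on the moduli space of compact `B`-fields. -/
noncomputable def moduliDist : Moduli.{u, v} B → Moduli.{u, v} B → ℝ :=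
  Quotient.lift₂ (fun X Y => BField.ghDist X.toBField Y.toBField)
    fun _ _ _ _ hX hY => BField.ghDist_congr hX hY

end CompactBField

/-! A Urysohn field is universal (`IsUrysohn.exists_isEmbedding`) and homogeneous for compact
subfields (`IsUrysohn.exists_aut`). Hence any `Z` competing in the Gromov–Hausdorff infimum embeds
in `U`, and the copies of `X` and `Y` found there are translates, by automorphisms, of copies fixed
beforehand. So the Gromov–Hausdorff distance is the infimum of Hausdorff distances between
translates. By homogeneity again, isometry classes of compact fields are exactly orbits. Since
automorphisms act isometrically on compact subfields, the quotient metric is the distance between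
orbits. It separates orbits: if translates of `L` approach `K`, a limit of the automorphisms
restricted to `L` is an isometry onto `K` over `B`, and homogeneity applies. Universality and
homogeneity rest on strengthening the extension property from finite to compact sets
(`IsUrysohn.exists_of_isCompact`), followed by inductive extension of partial isometries along a
dense sequence. -/

open Filter Topology

/-! ### Quotient metrics of isometric group actions. -/

section OrbitDist

variable {G α : Type*} [Group G] [PseudoMetricSpace α] [MulAction G α]

theorem bddBelow_range_dist_smul (x y : α) : BddBelow (Set.range fun g : G => dist x (g • y)) :=
  ⟨0, by rintro _ ⟨g, rfl⟩; exact dist_nonneg⟩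

theorem iInf_dist_smul_right (x y : α) (h : G) :
    ⨅ g : G, dist x (g • h • y) = ⨅ g : G, dist x (g • y) := by
  rw [← (Equiv.mulRight h).iInf_comp (g := fun g : G => dist x (g • y))]
  refine iInf_congr fun g => ?_
  rw [Equiv.coe_mulRight, mul_smul]

variable [IsIsometricSMul G α]

theorem iInf_dist_smul_comm (x y : α) : ⨅ g : G, dist x (g • y) = ⨅ g : G, dist y (g • x) := by
  rw [← (Equiv.inv G).iInf_comp]
  refine iInf_congr fun g => ?_
  rw [Equiv.inv_apply, dist_comm, ← dist_smul g, smul_inv_smul]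

theorem iInf_dist_smul_left (x y : α) (h : G) :
    ⨅ g : G, dist (h • x) (g • y) = ⨅ g : G, dist x (g • y) := by
  rw [iInf_dist_smul_comm, iInf_dist_smul_right, iInf_dist_smul_comm]

variable (G α) in
/-- The distance between two orbits of an isometric group action. -/
noncomputable def orbitDist :
    Quotient (MulAction.orbitRel G α) → Quotient (MulAction.orbitRel G α) → ℝ :=
  Quotient.lift₂ (fun x y => ⨅ g : G, dist x (g • y)) (by
    rintro a b c d ⟨g, rfl⟩ ⟨h, rfl⟩
    exact (iInf_dist_smul_left _ _ _).trans (iInf_dist_smul_right _ _ _))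

theorem isPseudometric_orbitDist : IsPseudometric (orbitDist G α) := by
  refine ⟨?_, ?_, ?_⟩
  · rintro ⟨x⟩
    refine le_antisymm ?_ (Real.iInf_nonneg fun g => dist_nonneg)
    exact (ciInf_le (bddBelow_range_dist_smul x x) 1).trans (by rw [one_smul, dist_self])
  · rintro ⟨x⟩ ⟨y⟩
    exact iInf_dist_smul_comm x y
  · rintro ⟨x⟩ ⟨y⟩ ⟨z⟩
    refine le_ciInf_add_ciInf fun g h => ?_
    refine (ciInf_le (bddBelow_range_dist_smul x z) (g * h)).trans ?_
    refine (dist_triangle x (g • y) ((g * h) • z)).trans ?_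
    rw [mul_smul, dist_smul]

/-- For an isometric group action, the quotient metric on the orbit space is the distance between
orbits. -/
theorem quotientDist_orbitRel : quotientDist (MulAction.orbitRel G α) = orbitDist G α := by
  funext p q
  -- The orbit distance is itself an admissible pseudometric. Any other one is constant on orbits,
  -- hence bounded by every `dist x (g • y)`.
  refine IsGreatest.csSup_eq ⟨⟨_, isPseudometric_orbitDist, fun x y => ?_, rfl⟩, ?_⟩
  · exact (ciInf_le (bddBelow_range_dist_smul x y) 1).trans (by rw [one_smul])
  · rintro _ ⟨ρ, -, hρ, rfl⟩
    induction p, q using Quotient.inductionOn₂ with | _ x y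
    refine le_ciInf fun g => ?_
    have : Quotient.mk (MulAction.orbitRel G α) y = Quotient.mk _ (g • y) :=
      Quotient.sound ⟨g⁻¹, inv_smul_smul g y⟩
    rw [this]
    exact hρ x (g • y)

theorem iInf_dist_smul_smul (x y : α) :
    ⨅ p : G × G, dist (p.1 • x) (p.2 • y) = ⨅ g : G, dist x (g • y) := by
  -- By invariance of the distance, only `p.1⁻¹ * p.2` matters.
  have : (fun p : G × G => dist (p.1 • x) (p.2 • y))
      = (fun g : G => dist x (g • y)) ∘ fun p : G × G => p.1⁻¹ * p.2 := by
    funext p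
    rw [Function.comp_apply, ← dist_smul p.1⁻¹, inv_smul_smul, mul_smul]
  rw [this]
  exact Function.Surjective.iInf_comp (f := fun p : G × G => p.1⁻¹ * p.2)
    (fun g => ⟨(1, g), by simp⟩) fun g : G => dist x (g • y)

end OrbitDist

namespace BField

/-! ### Partial isometries over `B`. -/

section PartialIso

variable {B : Type u} [MetricSpace B] {X Y U : BField.{u, v} B}

/-- A relation between two `B`-fields that is an isometry over `B` from its domain to its range. -/
structure IsPartialIso (R : Set (X × Y)) : Prop where
  dist_eq : ∀ p ∈ R, ∀ q ∈ R, dist p.1 q.1 = dist p.2 q.2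
  proj_eq : ∀ p ∈ R, Y.proj p.2 = X.proj p.1

theorem IsPartialIso.swap {R : Set (X × Y)} (hR : IsPartialIso R) :
    IsPartialIso (Prod.swap '' R) := by
  constructor
  · rintro _ ⟨p, hp, rfl⟩ _ ⟨q, hq, rfl⟩
    exact (hR.dist_eq p hp q hq).symm
  · rintro _ ⟨p, hp, rfl⟩
    exact (hR.proj_eq p hp).symm

theorem IsPartialIso.closure {R : Set (X × Y)} (hR : IsPartialIso R) :
    IsPartialIso (closure R) := by
  constructor
  · intro p hp q hq
    have hc : IsClosed {z : (X × Y) × (X × Y) | dist z.1.1 z.2.1 = dist z.1.2 z.2.2} :=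
      isClosed_eq (by fun_prop) (by fun_prop)
    have : (p, q) ∈ _root_.closure (R ×ˢ R) := by
      rw [closure_prod_eq]; exact ⟨hp, hq⟩
    exact closure_minimal (fun z hz => hR.dist_eq _ hz.1 _ hz.2) hc this
  · intro p hp
    have hc : IsClosed {z : X × Y | Y.proj z.2 = X.proj z.1} :=
      isClosed_eq (Y.lipschitz_proj.continuous.comp continuous_snd)
        (X.lipschitz_proj.continuous.comp continuous_fst)
    exact closure_minimal (fun z hz => hR.proj_eq _ hz) hc hp

/-- A sequence in the domain converging to `x` has Cauchy partners, because `R` preserves distances;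
completeness of `Y` supplies their limit. -/
theorem IsPartialIso.exists_mem_closure {R : Set (X × Y)} (hR : IsPartialIso R)
    (hd : Dense (Prod.fst '' R)) (x : X) : ∃ y, (x, y) ∈ _root_.closure R := by
  obtain ⟨s, hs, hlim⟩ := mem_closure_iff_seq_limit.1 (hd x)
  choose p hpR hps using hs
  have hc : CauchySeq fun n => (p n).2 := by
    have := hlim.cauchySeq
    rw [Metric.cauchySeq_iff] at this ⊢
    intro ε hε
    obtain ⟨N, hN⟩ := this ε hε
    refine ⟨N, fun m hm n hn => ?_⟩
    rw [← hR.dist_eq _ (hpR m) _ (hpR n), hps, hps]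
    exact hN m hm n hn
  obtain ⟨y, hy⟩ := cauchySeq_tendsto_of_complete hc
  refine ⟨y, mem_closure_of_tendsto (f := p) (b := atTop) ?_ (Eventually.of_forall hpR)⟩
  have h1 : Tendsto (fun n => (p n).1) atTop (𝓝 x) := by simpa only [hps] using hlim
  exact h1.prodMk_nhds hy

theorem IsPartialIso.isEmbedding {R : Set (X × Y)} (hR : IsPartialIso R) {φ : X → Y}
    (hφ : ∀ x, (x, φ x) ∈ R) : IsEmbedding X Y φ :=
  ⟨Isometry.of_dist_eq fun x y => (hR.dist_eq _ (hφ x) _ (hφ y)).symm,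
    fun x => hR.proj_eq _ (hφ x)⟩

theorem IsPartialIso.iUnion {R : ℕ → Set (X × Y)} (hmono : Monotone R)
    (hR : ∀ n, IsPartialIso (R n)) : IsPartialIso (⋃ n, R n) := by
  constructor
  · intro p hp q hq
    obtain ⟨m, hm⟩ := Set.mem_iUnion.1 hp
    obtain ⟨n, hn⟩ := Set.mem_iUnion.1 hq
    exact (hR (max m n)).dist_eq p (hmono (le_max_left m n) hm) q (hmono (le_max_right m n) hn)
  · intro p hp
    obtain ⟨m, hm⟩ := Set.mem_iUnion.1 hp
    exact (hR m).proj_eq p hm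

theorem IsPartialIso.insert {R : Set (X × Y)} (hR : IsPartialIso R) {x : X} {y : Y}
    (hd : ∀ p ∈ R, dist y p.2 = dist x p.1) (hy : Y.proj y = X.proj x) :
    IsPartialIso (insert (x, y) R) := by
  constructor
  · rintro p (rfl | hp) q (rfl | hq)
    · simp
    · exact (hd q hq).symm
    · rw [dist_comm, dist_comm p.2]; exact (hd p hp).symm
    · exact hR.dist_eq p hp q hq
  · rintro p (rfl | hp)
    · exact hy
    · exact hR.proj_eq p hp

/-! ### Realizing prescribed distances: from finite to compact sets. -/

/-- The set of pairs `(a, r)` prescribes the distances `r` from the points `a` to a new point lying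
over `b`, in a way compatible with the triangle inequality and with the projection. -/
structure IsKatetov (U : BField.{u, v} B) (b : B) (S : Set (U × ℝ)) : Prop where
  le_add_dist : ∀ p ∈ S, ∀ q ∈ S, p.2 ≤ q.2 + dist p.1 q.1
  dist_le_add : ∀ p ∈ S, ∀ q ∈ S, dist p.1 q.1 ≤ p.2 + q.2
  dist_proj_le : ∀ p ∈ S, dist b (U.proj p.1) ≤ p.2

theorem IsKatetov.mono {b : B} {S T : Set (U × ℝ)} (hS : IsKatetov U b S) (h : T ⊆ S) :
    IsKatetov U b T :=
  ⟨fun p hp q hq => hS.1 p (h hp) q (h hq), fun p hp q hq => hS.2 p (h hp) q (h hq),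
    fun p hp => hS.3 p (h hp)⟩

/-- A finite set of prescribed distances is realized in a Urysohn field. -/
theorem IsUrysohn.exists_of_finite (hU : U.IsUrysohn) {b : B} {S : Set (U × ℝ)} (hf : S.Finite)
    (hS : IsKatetov U b S) : ∃ w : U, U.proj w = b ∧ ∀ p ∈ S, dist w p.1 = p.2 := by
  -- The extension property only adds a new point at positive distance from `A`. If some prescribed
  -- distance is zero, the corresponding old point already works.
  by_cases h0 : ∃ p ∈ S, p.2 = 0
  · obtain ⟨p, hp, hp0⟩ := h0
    refine ⟨p.1, ?_, fun q hq => ?_⟩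
    · have := hS.dist_proj_le p hp
      rw [hp0] at this
      exact (dist_le_zero.1 this).symm
    · have h1 := hS.dist_le_add p hp q hq
      have h2 := hS.le_add_dist q hq p hp
      rw [dist_comm] at h2
      linarith
  · push Not at h0
    have hpos : ∀ p ∈ S, 0 < p.2 := fun p hp =>
      lt_of_le_of_ne (dist_nonneg.trans (hS.dist_proj_le p hp)) (h0 p hp).symm
    let A : Set U := Prod.fst '' S
    have hA : ∀ a : A, ∃ r : ℝ, ((a : U), r) ∈ S := by
      rintro ⟨_, p, hp, rfl⟩
      exact ⟨p.2, hp⟩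
    choose f hfS using hA
    let d : Option A → Option A → ℝ
      | none, none => 0
      | some a, none => f a
      | none, some a => f a
      | some a, some c => dist (a : U) c
    let _ : MetricSpace (Option A) :=
      { dist := d
        dist_self := by rintro (_ | a) <;> simp [d]
        dist_comm := by rintro (_ | a) (_ | c) <;> simp [d, dist_comm]
        dist_triangle := by
          have hle := fun a c => hS.le_add_dist _ (hfS a) _ (hfS c)
          have hadd := fun a c => hS.dist_le_add _ (hfS a) _ (hfS c)
          have hp := fun a => (hpos _ (hfS a)).le
          rintro (_ | a) (_ | c) (_ | e) <;> simp only [d]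
          · simp
          · simp
          · linarith [hp c]
          · have := hle e c
            rw [dist_comm] at this
            exact this
          · simp
          · exact hadd a e
          · have := hle a c
            linarith
          · exact dist_triangle _ _ _
        eq_of_dist_eq_zero := by
          have hp := fun a => (hpos _ (hfS a)).ne'
          rintro (_ | a) (_ | c) h
          · rfl
          · exact absurd h (hp c)
          · exact absurd h (hp a)
          · exact congrArg some (Subtype.ext (dist_eq_zero.1 h)) }
    let φ : Option A → B := fun o => o.elim b fun a => U.proj a
    have hφ : LipschitzWith 1 φ := by
      refine LipschitzWith.of_dist_le_mul ?_
      rw [NNReal.coe_one]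
      rintro (_ | a) (_ | c) <;> rw [one_mul]
      · exact (dist_self b).le.trans dist_nonneg
      · exact hS.dist_proj_le _ (hfS c)
      · exact (dist_comm _ _).trans_le (hS.dist_proj_le _ (hfS a))
      · exact (U.lipschitz_proj.dist_le_mul (a : U) c).trans_eq (one_mul _)
    obtain ⟨i, hi, hia, hip⟩ := hU A (hf.image _) (fun _ _ => rfl) φ hφ fun _ => rfl
    refine ⟨i none, hip none, fun p hp => ?_⟩
    let a : A := ⟨p.1, p, hp, rfl⟩
    have h1 : dist (i none) p.1 = f a := by
      have := hi.dist_eq none (some a)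
      rw [hia] at this
      exact this
    -- `S` is not assumed to be a graph, but the Katětov inequality forces pairs over the same point
    -- to carry the same distance.
    have h2 := hS.le_add_dist _ (hfS a) p hp
    have h3 := hS.le_add_dist p hp _ (hfS a)
    simp only [a, dist_self, add_zero] at h2 h3
    rw [h1]
    exact le_antisymm h2 h3

/-- Take a finite `δ / 2`-net of `S`: passing from a pair to a nearby one changes the distance to
`w` and the prescribed value by less than `δ / 2` each. -/
theorem exists_finite_approx {S : Set (U × ℝ)} (hc : IsCompact S) {δ : ℝ}
    (hδ : 0 < δ) :
    ∃ T ⊆ S, T.Finite ∧ ∀ w : U, (∀ p ∈ T, dist w p.1 = p.2) →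
      ∀ p ∈ S, |dist w p.1 - p.2| ≤ δ := by
  obtain ⟨T, hTS, hT, hcov⟩ := hc.finite_cover_balls (half_pos hδ)
  refine ⟨T, hTS, hT, fun w hw p hp => ?_⟩
  obtain ⟨q, hq, hpq⟩ := Set.mem_iUnion₂.1 (hcov hp)
  have hpq' : max (dist p.1 q.1) (dist p.2 q.2) < δ / 2 := hpq
  obtain ⟨h1, h2⟩ := max_lt_iff.1 hpq'
  rw [Real.dist_eq, abs_lt] at h2
  have h3 := hw q hq
  have h4 := dist_triangle w p.1 q.1
  have h5 := dist_triangle_right w p.1 q.1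
  rw [abs_le]
  constructor <;> linarith

/-- An approximate realization of prescribed distances can be moved slightly to become a better
one. -/
theorem IsUrysohn.exists_improve (hU : U.IsUrysohn) {b : B} {S : Set (U × ℝ)} (hc : IsCompact S)
    (hS : IsKatetov U b S) {v : U} (hv : U.proj v = b) {ε δ : ℝ} (hε : 0 < ε) (hδ : 0 < δ)
    (hvS : ∀ p ∈ S, |dist v p.1 - p.2| ≤ ε) :
    ∃ w : U, U.proj w = b ∧ (∀ p ∈ S, |dist w p.1 - p.2| ≤ δ) ∧ dist v w ≤ ε := by
  obtain ⟨T, hTS, hT, hTw⟩ := exists_finite_approx hc hδ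
  rcases T.eq_empty_or_nonempty with rfl | hne
  · exact ⟨v, hv, hTw v (by simp), by rw [dist_self]; exact hε.le⟩
  obtain ⟨q, hq, hmax⟩ := Set.exists_max_image T (fun p => |dist v p.1 - p.2|) hT hne
  -- The worst error of `v` on the net is the least distance from `v` at which a correct point could
  -- lie. Prescribing exactly this distance to `v` stays compatible, and `c ≤ ε` because the net
  -- lies in `S`.
  set c := |dist v q.1 - q.2| with hcdef
  have hcp : ∀ p ∈ T, c ≤ p.2 + dist p.1 v := by
    intro p hp
    have h1 := hS.le_add_dist q (hTS hq) p (hTS hp)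
    have h2 := hS.dist_le_add q (hTS hq) p (hTS hp)
    have h3 := dist_triangle v p.1 q.1
    have h4 := dist_triangle_right q.1 p.1 v
    rw [hcdef, dist_comm p.1 v]
    rw [dist_comm v p.1, dist_comm p.1 q.1] at h3
    rw [dist_comm v p.1, abs_le]
    rw [dist_comm q.1 v] at h4
    constructor <;> linarith
  have hK : IsKatetov U b (insert (v, c) T) := by
    have hT' := hS.mono hTS
    constructor
    · rintro p (rfl | hp) r (rfl | hr)
      · simp
      · have := hcp r hr
        rw [dist_comm] at this
        exact this
      · have := (abs_le.1 (hmax p hp)).1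
        rw [dist_comm] at this
        simp only
        linarith
      · exact hT'.le_add_dist p hp r hr
    · rintro p (rfl | hp) r (rfl | hr)
      · simp [hcdef]
      · have := (abs_le.1 (hmax r hr)).2
        simp only
        linarith
      · have := (abs_le.1 (hmax p hp)).2
        rw [dist_comm] at this
        simp only
        linarith
      · exact hT'.dist_le_add p hp r hr
    · rintro p (rfl | hp)
      · simp [hcdef, hv]
      · exact hT'.dist_proj_le p hp
  obtain ⟨w, hwb, hw⟩ := hU.exists_of_finite (hT.insert _) hK
  refine ⟨w, hwb, hTw w fun p hp => hw p (Or.inr hp), ?_⟩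
  rw [dist_comm, hw (v, c) (Or.inl rfl)]
  exact hvS q (hTS hq)

/-- A compact set of prescribed distances is realized in a Urysohn field. -/
theorem IsUrysohn.exists_of_isCompact (hU : U.IsUrysohn) {b : B} {S : Set (U × ℝ)}
    (hc : IsCompact S) (hS : IsKatetov U b S) :
    ∃ w : U, U.proj w = b ∧ ∀ p ∈ S, dist w p.1 = p.2 := by
  -- The initial point has error at most `1 = (1 / 2) ^ 0`. Moving by at most the current error
  -- while halving the error bound gives a Cauchy sequence whose limit is exact.
  obtain ⟨T, hTS, hT, hTw⟩ := exists_finite_approx hc one_pos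
  obtain ⟨v₀, hv₀, hv₀T⟩ := hU.exists_of_finite hT (hS.mono hTS)
  let P : ℕ → U → Prop := fun n v =>
    U.proj v = b ∧ ∀ p ∈ S, |dist v p.1 - p.2| ≤ (1 / 2 : ℝ) ^ n
  have step : ∀ (n : ℕ) (v : {v // P n v}), ∃ w : {w // P (n + 1) w},
      dist v.1 w.1 ≤ (1 / 2 : ℝ) ^ n := by
    rintro n ⟨v, hv, hvS⟩
    obtain ⟨w, hw, hwS, hvw⟩ := hU.exists_improve hc hS hv
      (ε := (1 / 2 : ℝ) ^ n) (δ := (1 / 2 : ℝ) ^ (n + 1)) (by positivity) (by positivity) hvS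
    exact ⟨⟨w, hw, hwS⟩, hvw⟩
  choose next hnext using step
  let s : ∀ n, {v // P n v} := fun n =>
    Nat.rec ⟨v₀, hv₀, by simpa using hTw v₀ hv₀T⟩ (fun n v => next n v) n
  have hs : ∀ n, dist (s n).1 (s (n + 1)).1 ≤ 1 * (1 / 2 : ℝ) ^ n := fun n => by
    rw [one_mul]; exact hnext n (s n)
  obtain ⟨w, hw⟩ := cauchySeq_tendsto_of_complete
    (cauchySeq_of_le_geometric (1 / 2 : ℝ) 1 (by norm_num) hs)
  refine ⟨w, ?_, fun p hp => ?_⟩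
  · have h := (U.lipschitz_proj.continuous.tendsto w).comp hw
    refine tendsto_nhds_unique h ?_
    exact tendsto_const_nhds.congr fun n => ((s n).2.1).symm
  · have h1 : Tendsto (fun n => |dist (s n).1 p.1 - p.2|) atTop (𝓝 |dist w p.1 - p.2|) :=
      ((hw.dist tendsto_const_nhds).sub_const _).abs
    have h2 : Tendsto (fun n : ℕ => (1 / 2 : ℝ) ^ n) atTop (𝓝 0) :=
      tendsto_pow_atTop_nhds_zero_of_lt_one (by norm_num) (by norm_num)
    have h3 := le_of_tendsto_of_tendsto' h1 h2 fun n => (s n).2.2 p hp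
    exact sub_eq_zero.1 (abs_nonpos_iff.1 h3)

/-! ### Universality and homogeneity. -/

/-- Compact partial isometries into a Urysohn field extend to one more point. -/
theorem IsUrysohn.exists_insert (hU : U.IsUrysohn) {R : Set (X × U)} (hc : IsCompact R)
    (hR : IsPartialIso R) (x : X) : ∃ u : U, IsPartialIso (insert (x, u) R) := by
  have hS : IsKatetov U (X.proj x) ((fun p : X × U => (p.2, dist x p.1)) '' R) := by
    constructor
    · rintro _ ⟨p, hp, rfl⟩ _ ⟨q, hq, rfl⟩
      simp only
      rw [← hR.dist_eq p hp q hq, dist_comm p.1 q.1]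
      exact dist_triangle _ _ _
    · rintro _ ⟨p, hp, rfl⟩ _ ⟨q, hq, rfl⟩
      simp only
      rw [← hR.dist_eq p hp q hq]
      exact dist_triangle_left _ _ _
    · rintro _ ⟨p, hp, rfl⟩
      simp only
      rw [hR.proj_eq p hp]
      simpa using X.lipschitz_proj.dist_le_mul x p.1
  obtain ⟨u, hu, huS⟩ := hU.exists_of_isCompact (hc.image (by fun_prop)) hS
  exact ⟨u, hR.insert (fun p hp => huS _ ⟨p, hp, rfl⟩) hu⟩

/-- Iterating one-step extensions of partial isometries over a countable set of requirements. -/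
theorem IsPartialIso.exists_extension {R : Set (X × Y)} (hc : IsCompact R) (hR : IsPartialIso R)
    (Q : ℕ → X × Y → Prop)
    (step : ∀ (n : ℕ) (R : Set (X × Y)), IsCompact R → IsPartialIso R →
      ∃ R', R ⊆ R' ∧ IsCompact R' ∧ IsPartialIso R' ∧ ∃ p ∈ R', Q n p) :
    ∃ R', R ⊆ R' ∧ IsPartialIso R' ∧ ∀ n, ∃ p ∈ R', Q n p := by
  choose next hsub hcomp hiso hQ using step
  let s : ℕ → {R : Set (X × Y) // IsCompact R ∧ IsPartialIso R} := fun n =>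
    Nat.rec ⟨R, hc, hR⟩ (fun n R => ⟨next n R.1 R.2.1 R.2.2, hcomp .., hiso ..⟩) n
  have hmono : Monotone fun n => (s n).1 := monotone_nat_of_le_succ fun n => hsub n _ _ _
  refine ⟨⋃ n, (s n).1, Set.subset_iUnion (fun n => (s n).1) 0,
    IsPartialIso.iUnion hmono fun n => (s n).2.2, fun n => ?_⟩
  obtain ⟨p, hp, hpQ⟩ := hQ n (s n).1 (s n).2.1 (s n).2.2
  exact ⟨p, Set.mem_iUnion.2 ⟨n + 1, hp⟩, hpQ⟩

/-- Every `B`-field embeds in a Urysohn field over `B`. -/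
theorem IsUrysohn.exists_isEmbedding (hU : U.IsUrysohn) (X : BField.{u, v} B) :
    ∃ φ : X → U, IsEmbedding X U φ := by
  rcases isEmpty_or_nonempty X with hX | hX
  · exact ⟨isEmptyElim, fun x => isEmptyElim x, fun x => isEmptyElim x⟩
  obtain ⟨R, -, hR, hRd⟩ := IsPartialIso.exists_extension (X := X) (Y := U) isCompact_empty
    ⟨by simp, by simp⟩ (fun n p => p.1 = denseSeq X n) fun n R hc hR => by
      obtain ⟨u, hu⟩ := hU.exists_insert hc hR (denseSeq X n)
      exact ⟨_, Set.subset_insert _ _, hc.insert _, hu, _, Set.mem_insert _ _, rfl⟩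
  have hd : Dense (Prod.fst '' R) := (denseRange_denseSeq X).mono <| by
    rintro _ ⟨n, rfl⟩
    exact hRd n
  choose φ hφ using hR.exists_mem_closure hd
  exact ⟨φ, hR.closure.isEmbedding hφ⟩

/-- Homogeneity of Urysohn fields: isometries over `B` between compact subfields extend to
automorphisms. -/
theorem IsUrysohn.exists_aut (hU : U.IsUrysohn) [CompactSpace X] {i j : X → U}
    (hi : IsEmbedding X U i) (hj : IsEmbedding X U j) :
    ∃ g : U.Aut, ∀ x, (g : U ≃ᵢ U) (i x) = j x := by
  rcases isEmpty_or_nonempty U with hX | hX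
  · exact ⟨1, fun x => isEmptyElim (i x)⟩
  have hR₀ : IsPartialIso (Set.range fun x => (i x, j x)) := by
    constructor
    · rintro _ ⟨x, rfl⟩ _ ⟨y, rfl⟩
      exact (hi.1.dist_eq x y).trans (hj.1.dist_eq x y).symm
    · rintro _ ⟨x, rfl⟩
      exact (hj.2 x).trans (hi.2 x).symm
  -- The "back" step: enlarge the range by extending the inverse relation.
  have hsucc : ∀ {R : Set (U × U)}, IsCompact R → IsPartialIso R → ∀ y : U,
      ∃ u : U, IsPartialIso (insert (u, y) R) := by
    intro R hc hR y
    obtain ⟨u, hu⟩ := hU.exists_insert (hc.image continuous_swap) hR.swap y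
    refine ⟨u, ?_⟩
    have := hu.swap
    rwa [Set.image_insert_eq, Set.image_image, Set.image_congr (fun p _ => Prod.swap_swap p),
      Set.image_id'] at this
  obtain ⟨R, hR₀R, hR, hRd⟩ := IsPartialIso.exists_extension
    (isCompact_range (hi.1.continuous.prodMk hj.1.continuous)) hR₀
    -- Back-and-forth: even stages make the domain dense, odd stages the range.
    (fun n p => if Even n then p.1 = denseSeq U (n / 2) else p.2 = denseSeq U (n / 2))
    fun n R hc hR => by
      split_ifs
      · obtain ⟨u, hu⟩ := hU.exists_insert hc hR (denseSeq U (n / 2))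
        exact ⟨_, Set.subset_insert _ _, hc.insert _, hu, _, Set.mem_insert _ _, rfl⟩
      · obtain ⟨u, hu⟩ := hsucc hc hR (denseSeq U (n / 2))
        exact ⟨_, Set.subset_insert _ _, hc.insert _, hu, _, Set.mem_insert _ _, rfl⟩
  have hd₁ : Dense (Prod.fst '' R) := (denseRange_denseSeq U).mono <| by
    rintro _ ⟨n, rfl⟩
    have := hRd (2 * n)
    simp only [even_two_mul, if_true, Nat.mul_div_cancel_left _ two_pos] at this
    exact this
  have hd₂ : Dense (Prod.fst '' (Prod.swap '' R)) := (denseRange_denseSeq U).mono <| by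
    rintro _ ⟨n, rfl⟩
    have := hRd (2 * n + 1)
    simp only [Nat.not_even_two_mul_add_one, if_false, show (2 * n + 1) / 2 = n by omega] at this
    obtain ⟨p, hp, hpn⟩ := this
    exact ⟨p.swap, ⟨p, hp, rfl⟩, hpn⟩
  choose φ hφ using hR.exists_mem_closure hd₁
  have hcl := hR.closure
  have hemb := hcl.isEmbedding hφ
  -- The closure of `R` is the graph of `φ`: two partners of one point are at distance zero.
  have huniq : ∀ p ∈ _root_.closure R, φ p.1 = p.2 := fun p hp => by
    have := hcl.dist_eq _ (hφ p.1) p hp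
    rw [dist_self] at this
    exact dist_eq_zero.1 this.symm
  have hsurj : Function.Surjective φ := by
    intro y
    obtain ⟨x, hx⟩ := hR.swap.exists_mem_closure hd₂ y
    refine ⟨x, huniq (x, y) ?_⟩
    have := image_closure_subset_closure_image continuous_swap (Set.mem_image_of_mem Prod.swap hx)
    rwa [Set.image_image, Set.image_congr (fun p _ => Prod.swap_swap p), Set.image_id'] at this
  exact ⟨⟨IsometryEquiv.mk (Equiv.ofBijective φ ⟨hemb.1.injective, hsurj⟩) hemb.1, hemb.2⟩,
    fun x => huniq (i x, j x) (subset_closure (hR₀R ⟨x, rfl⟩))⟩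

end PartialIso

/-! ### Compact subfields and orbits. -/

section CompactSubfield

variable {B : Type u} [MetricSpace B] {U : BField.{u, v} B}

theorem coe_smul_compactSubfield (g : U.Aut) (K : U.CompactSubfield) :
    ((g • K : U.CompactSubfield) : Set U) = (g : U ≃ᵢ U) '' K := rfl

instance : IsIsometricSMul U.Aut U.CompactSubfield :=
  ⟨fun g => Isometry.of_dist_eq fun K L => by
    rw [Metric.NonemptyCompacts.dist_eq, Metric.NonemptyCompacts.dist_eq, coe_smul_compactSubfield,
      coe_smul_compactSubfield, Metric.hausdorffDist_image (g : U ≃ᵢ U).isometry]⟩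

/-- A compact subset of a `B`-field, as a `B`-field. -/
def CompactSubfield.toCompactBField (K : U.CompactSubfield) : CompactBField.{u, v} B where
  carrier := K
  completeSpace := K.isCompact.isComplete.completeSpace_coe
  proj x := U.proj x
  lipschitz_proj := fun x y => U.lipschitz_proj x y
  compactSpace := isCompact_iff_compactSpace.1 K.isCompact
  nonempty := K.nonempty.to_subtype

theorem CompactSubfield.isEmbedding_val (K : U.CompactSubfield) :
    IsEmbedding (CompactSubfield.toCompactBField K).toBField U (fun x => x.1) :=
  ⟨isometry_subtype_coe, fun _ => rfl⟩

/-- The image of a compact `B`-field under an embedding. -/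
def IsEmbedding.range {X : CompactBField.{u, v} B} {i : X.toBField → U}
    (hi : IsEmbedding X.toBField U i) : U.CompactSubfield where
  carrier := Set.range i
  isCompact' := haveI := X.compactSpace; isCompact_range hi.1.continuous
  nonempty' := haveI := X.nonempty; Set.range_nonempty i

theorem IsEmbedding.comp {X Y Z : BField.{u, v} B} {f : Y → Z} {g : X → Y}
    (hf : IsEmbedding Y Z f) (hg : IsEmbedding X Y g) : IsEmbedding X Z (f ∘ g) :=
  ⟨hf.1.comp hg.1, fun x => (hf.2 (g x)).trans (hg.2 x)⟩

theorem isEmbedding_aut (g : U.Aut) : IsEmbedding U U (g : U ≃ᵢ U) :=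
  ⟨(g : U ≃ᵢ U).isometry, g.2⟩

/-- The Gromov–Hausdorff distance is computed inside a Urysohn field. -/
theorem IsUrysohn.ghDist_eq (hU : U.IsUrysohn) {X Y : CompactBField.{u, v} B}
    {i : X.toBField → U} {j : Y.toBField → U} (hi : IsEmbedding X.toBField U i)
    (hj : IsEmbedding Y.toBField U j) :
    ghDist X.toBField Y.toBField
      = ⨅ p : U.Aut × U.Aut, dist (p.1 • hi.range) (p.2 • hj.range) := by
  have := X.compactSpace
  have := Y.compactSpace
  have hdist : ∀ p : U.Aut × U.Aut, dist (p.1 • hi.range) (p.2 • hj.range)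
      = Metric.hausdorffDist (Set.range ((p.1 : U ≃ᵢ U) ∘ i)) (Set.range ((p.2 : U ≃ᵢ U) ∘ j)) := by
    intro p
    rw [Set.range_comp, Set.range_comp]
    rfl
  refine congrArg sInf (Set.Subset.antisymm ?_ ?_)
  · rintro r ⟨Z, φ, ψ, hφ, hψ, rfl⟩
    obtain ⟨k, hk⟩ := hU.exists_isEmbedding Z
    obtain ⟨g, hg⟩ := hU.exists_aut hi (hk.comp hφ)
    obtain ⟨h, hh⟩ := hU.exists_aut hj (hk.comp hψ)
    refine ⟨(g, h), (hdist (g, h)).trans ?_⟩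
    rw [show ((g : U ≃ᵢ U) ∘ i) = k ∘ φ from funext hg,
      show ((h : U ≃ᵢ U) ∘ j) = k ∘ ψ from funext hh, Set.range_comp, Set.range_comp,
      Metric.hausdorffDist_image hk.1]
  -- Conversely, `U` itself is an admissible ambient field.
  · rintro r ⟨p, rfl⟩
    exact ⟨U, _, _, (isEmbedding_aut p.1).comp hi, (isEmbedding_aut p.2).comp hj, hdist p⟩

/-- Two compact subfields with isometric images are in the same orbit. -/
theorem IsUrysohn.exists_smul_eq (hU : U.IsUrysohn) {X Y : CompactBField.{u, v} B}
    {i : X.toBField → U} {j : Y.toBField → U} (hi : IsEmbedding X.toBField U i)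
    (hj : IsEmbedding Y.toBField U j) (h : IsIsometric X.toBField Y.toBField) :
    ∃ g : U.Aut, g • hi.range = hj.range := by
  have := X.compactSpace
  obtain ⟨e, he⟩ := h
  obtain ⟨g, hg⟩ := hU.exists_aut hi (hj.comp ⟨e.isometry, he⟩)
  refine ⟨g, SetLike.coe_injective ?_⟩
  change (g : U ≃ᵢ U) '' Set.range i = Set.range j
  rw [← Set.range_comp, show ((g : U ≃ᵢ U) ∘ i) = j ∘ e from funext hg,
    e.surjective.range_comp]

/-- The isometry is `j⁻¹ ∘ g ∘ i`; unlike the converse, this needs no homogeneity. -/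
theorem isIsometric_of_smul_eq {X Y : CompactBField.{u, v} B}
    {i : X.toBField → U} {j : Y.toBField → U} (hi : IsEmbedding X.toBField U i)
    (hj : IsEmbedding Y.toBField U j) {g : U.Aut} (h : g • hi.range = hj.range) :
    IsIsometric X.toBField Y.toBField := by
  have hset : (g : U ≃ᵢ U) '' Set.range i = Set.range j :=
    congrArg (fun K : U.CompactSubfield => (K : Set U)) h
  have hex : ∀ x, ∃ y, j y = (g : U ≃ᵢ U) (i x) := fun x => by
    have : (g : U ≃ᵢ U) (i x) ∈ Set.range j := hset ▸ ⟨i x, ⟨x, rfl⟩, rfl⟩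
    exact this
  choose f hf using hex
  have hiso : Isometry f := Isometry.of_dist_eq fun x y => by
    rw [← hj.1.dist_eq, hf, hf, (g : U ≃ᵢ U).dist_eq, hi.1.dist_eq]
  have hsurj : Function.Surjective f := fun y => by
    have : j y ∈ (g : U ≃ᵢ U) '' Set.range i := hset ▸ ⟨y, rfl⟩
    obtain ⟨_, ⟨x, rfl⟩, hx⟩ := this
    exact ⟨x, hj.1.injective ((hf x).trans hx)⟩
  refine ⟨IsometryEquiv.mk (Equiv.ofBijective f ⟨hiso.injective, hsurj⟩) hiso, fun x => ?_⟩
  change Y.proj (f x) = X.proj x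
  rw [← hj.2, hf, g.2, hi.2]

theorem exists_dist_lt_of_dist_lt {K L : U.CompactSubfield} {r : ℝ} (h : dist K L < r) {x : U}
    (hx : x ∈ K) : ∃ y ∈ L, dist x y < r :=
  Metric.exists_dist_lt_of_hausdorffDist_lt hx h
    (Metric.hausdorffEDist_ne_top_of_nonempty_of_bounded K.nonempty L.nonempty
      K.isCompact.isBounded L.isCompact.isBounded)

/-- Compact subfields having arbitrarily close translates are isometric. -/
theorem isIsometric_of_iInf_dist_eq_zero {K L : U.CompactSubfield}
    (h : ⨅ g : U.Aut, dist K (g • L) = 0) :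
    IsIsometric (CompactSubfield.toCompactBField L).toBField
      (CompactSubfield.toCompactBField K).toBField := by
  have hex : ∀ n : ℕ, ∃ g : U.Aut, dist K (g • L) < 1 / ((n : ℝ) + 1) := fun n =>
    exists_lt_of_ciInf_lt (h.trans_lt (by positivity))
  choose g hg using hex
  have hLK : ∀ n (x : L), ∃ y : K, dist ((g n : U ≃ᵢ U) x) (y : U) < 1 / ((n : ℝ) + 1) := by
    intro n x
    obtain ⟨y, hy, hxy⟩ := exists_dist_lt_of_dist_lt ((dist_comm _ _).trans_lt (hg n))
      (x := (g n : U ≃ᵢ U) x) ⟨x, x.2, rfl⟩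
    exact ⟨⟨y, hy⟩, hxy⟩
  have hKL : ∀ n (y : K), ∃ x : L, dist ((g n : U ≃ᵢ U) x) (y : U) < 1 / ((n : ℝ) + 1) := by
    intro n y
    obtain ⟨_, ⟨x, hx, rfl⟩, hxy⟩ := exists_dist_lt_of_dist_lt (hg n) y.2
    exact ⟨⟨x, hx⟩, (dist_comm _ _).trans_lt hxy⟩
  choose r hr using hLK
  choose s hs using hKL
  have : CompactSpace K := isCompact_iff_compactSpace.1 K.isCompact
  have : CompactSpace L := isCompact_iff_compactSpace.1 L.isCompact
  -- An ultrafilter gives limits at all points of `L` simultaneously, in place of a diagonal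
  -- extraction of a subsequence.
  let F : Ultrafilter ℕ := hyperfilter ℕ
  have hF : (F : Filter ℕ) ≤ atTop := Nat.hyperfilter_le_atTop
  have hε : Tendsto (fun n : ℕ => 1 / ((n : ℝ) + 1)) F (𝓝 0) :=
    tendsto_one_div_add_atTop_nhds_zero_nat.mono_left hF
  have hlim : ∀ {C : U.CompactSubfield} [CompactSpace C] (t : ℕ → C),
      ∃ z : C, Tendsto t F (𝓝 z) := by
    intro C _ t
    obtain ⟨z, -, hz⟩ := isCompact_univ.ultrafilter_le_nhds (F.map t) (by simp)
    exact ⟨z, hz⟩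
  choose f hf using fun x : L => hlim fun n => r n x
  have hgr : ∀ x : L, Tendsto (fun n => dist ((g n : U ≃ᵢ U) x) (r n x : U)) F (𝓝 0) := fun x =>
    squeeze_zero (fun _ => dist_nonneg) (fun n => (hr n x).le) hε
  -- `g n x` is asymptotic to `r n x`, which stays in the compact set `K`, so both have the limit `f
  -- x`.
  have hgf : ∀ x : L, Tendsto (fun n => (g n : U ≃ᵢ U) x) F (𝓝 (f x : U)) := fun x =>
    (tendsto_iff_of_dist (hgr x)).2 ((continuous_subtype_val.tendsto _).comp (hf x))
  have hiso : Isometry f := Isometry.of_dist_eq fun x y => by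
    refine tendsto_nhds_unique ((hgf x).dist (hgf y)) ?_
    simp only [IsometryEquiv.dist_eq]
    exact tendsto_const_nhds
  have hproj : ∀ x : L, U.proj (f x) = U.proj x := fun x => by
    refine tendsto_nhds_unique ((U.lipschitz_proj.continuous.tendsto _).comp (hgf x)) ?_
    exact tendsto_const_nhds.congr fun n => ((g n).2 _).symm
  have hsurj : Function.Surjective f := by
    intro y
    -- The limit `x` of the approximate preimages `s n y` is a preimage: `g n x` lies within `dist x
    -- (s n y) + 1 / (n + 1)` of `y`.
    obtain ⟨x, hx⟩ := hlim fun n => s n y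
    refine ⟨x, Subtype.ext (tendsto_nhds_unique (hgf x) ?_)⟩
    have h0 : Tendsto (fun n => dist (x : U) (s n y : U) + 1 / ((n : ℝ) + 1)) F (𝓝 0) := by
      have := (tendsto_const_nhds (x := (x : U))).dist
        ((continuous_subtype_val.tendsto _).comp hx)
      simpa using this.add hε
    rw [tendsto_iff_dist_tendsto_zero]
    refine squeeze_zero (fun _ => dist_nonneg) (fun n => ?_) h0
    refine (dist_triangle _ ((g n : U ≃ᵢ U) (s n y)) _).trans ?_
    rw [IsometryEquiv.dist_eq]
    exact add_le_add le_rfl (hs n y).le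
  exact ⟨IsometryEquiv.mk (Equiv.ofBijective f ⟨hiso.injective, hsurj⟩) hiso, hproj⟩

theorem range_val_compactSubfield (K : U.CompactSubfield) :
    K.isEmbedding_val.range = K :=
  SetLike.coe_injective Subtype.range_coe

theorem subfieldDist_eq (K L : U.CompactSubfield) :
    U.subfieldDist (U.subfieldClass K) (U.subfieldClass L) = ⨅ g : U.Aut, dist K (g • L) :=
  congrFun₂ quotientDist_orbitRel (U.subfieldClass K) (U.subfieldClass L)

theorem IsUrysohn.isMetric_subfieldDist (hU : U.IsUrysohn) : IsMetric U.subfieldDist := by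
  refine ⟨by rw [subfieldDist, quotientDist_orbitRel]; exact isPseudometric_orbitDist, ?_⟩
  rintro ⟨K⟩ ⟨L⟩ h
  have h' := isIsometric_of_iInf_dist_eq_zero ((subfieldDist_eq K L).symm.trans h)
  obtain ⟨g, hg⟩ := hU.exists_smul_eq (CompactSubfield.isEmbedding_val L)
    (CompactSubfield.isEmbedding_val K) h'
  rw [range_val_compactSubfield, range_val_compactSubfield] at hg
  exact Quotient.sound ⟨g, hg⟩

/-- The moduli space of compact `B`-fields is the orbit space of the compact subfields of a Urysohn
field. -/
theorem IsUrysohn.exists_moduli_equiv (hU : U.IsUrysohn) :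
    ∃ e : CompactBField.Moduli.{u, v} B ≃ U.SubfieldQuotient,
      ∀ p q, U.subfieldDist (e p) (e q) = CompactBField.moduliDist B p q := by
  choose i hi using fun X : CompactBField.{u, v} B => hU.exists_isEmbedding X.toBField
  -- The chosen embeddings are arbitrary; homogeneity makes the orbit of the image depend only on
  -- the isometry class.
  let e : CompactBField.Moduli.{u, v} B → U.SubfieldQuotient :=
    Quotient.lift (fun X => U.subfieldClass (hi X).range) fun X Y h => by
      obtain ⟨g, hg⟩ := hU.exists_smul_eq (hi Y) (hi X) h.symm
      exact Quotient.sound ⟨g, hg⟩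
  have he : Function.Bijective e := by
    constructor
    · rintro ⟨X⟩ ⟨Y⟩ h
      obtain ⟨g, hg⟩ := Quotient.exact h
      exact Quotient.sound (isIsometric_of_smul_eq (hi Y) (hi X) hg).symm
    · rintro ⟨K⟩
      refine ⟨Quotient.mk _ (CompactSubfield.toCompactBField K), ?_⟩
      obtain ⟨g, hg⟩ := hU.exists_smul_eq (CompactSubfield.isEmbedding_val K)
        (hi (CompactSubfield.toCompactBField K)) (.refl _)
      rw [range_val_compactSubfield] at hg
      exact Quotient.sound ⟨g, hg⟩
  refine ⟨Equiv.ofBijective e he, ?_⟩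
  rintro ⟨X⟩ ⟨Y⟩
  exact (subfieldDist_eq _ _).trans
    ((iInf_dist_smul_smul _ _).symm.trans (hU.ghDist_eq (hi X) (hi Y)).symm)

end CompactSubfield

end BField

/-- Transports the metric axioms to the moduli space, so that the triangle inequality there requires
no gluing of fields. -/
theorem IsMetric.of_injective {α β : Type*} {d : α → α → ℝ} {d' : β → β → ℝ} (hd' : IsMetric d')
    {e : α → β} (he : Function.Injective e) (h : ∀ p q, d' (e p) (e q) = d p q) : IsMetric d := by
  refine ⟨⟨fun x => ?_, fun x y => ?_, fun x y z => ?_⟩, fun x y hxy => ?_⟩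
  · rw [← h, hd'.self]
  · rw [← h, ← h, hd'.symm]
  · rw [← h, ← h, ← h]; exact hd'.triangle _ _ _
  · exact he (hd'.eq_of_eq_zero _ _ ((h x y).trans hxy))

theorem mainTheorem5 {B : Type u} [MetricSpace B] [CompleteSpace B] [SeparableSpace B]
    (U : BField.{u, v} B) (hU : U.IsUrysohn) :
    -- the two distances are metrics
    IsMetric (CompactBField.moduliDist.{u, v} B) ∧
    IsMetric U.subfieldDist ∧
    -- the quotient metric is the infimum of the Hausdorff distance over automorphisms
    (∀ K L : U.CompactSubfield,
      U.subfieldDist (U.subfieldClass K) (U.subfieldClass L)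
        = ⨅ p : U.Aut × U.Aut, dist (p.1 • K) (p.2 • L)) ∧
    (∀ K L : U.CompactSubfield,
      U.subfieldDist (U.subfieldClass K) (U.subfieldClass L) = ⨅ g : U.Aut, dist K (g • L)) ∧
    -- the two metric spaces are isometric
    ∃ e : CompactBField.Moduli.{u, v} B ≃ U.SubfieldQuotient,
      ∀ p q, U.subfieldDist (e p) (e q) = CompactBField.moduliDist B p q := by
  obtain ⟨e, he⟩ := hU.exists_moduli_equiv
  exact ⟨hU.isMetric_subfieldDist.of_injective e.injective he, hU.isMetric_subfieldDist,
    fun K L => (BField.subfieldDist_eq K L).trans (iInf_dist_smul_smul K L).symm,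
    BField.subfieldDist_eq, e, he⟩
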